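/- Let $F$ be a non-discrete non-Archimedean local field, $q$ the number of elements of its residue field, $|\cdot|$ the standard absolute value on $F$ (so a uniformizer has absolute value $q^{-1}$), $B(0,r)=\{x\in F:|x|\le r\}$, $\mathcal O_F=B(0,1)$, and $\mathfrak m$ the Haar measure on $(F,+)$ with $\mathfrak m(\mathcal O_F)=1$. Fix a continuous unitary character $\chi$ of $(F,+)$ that is trivial on $\mathcal O_F$ and not constant on $B(0,q)$, and put $\widehat f(y)=\int_F f(x)\chi(xy)\,d\mathfrak m(x)$ for $f\in L^1(F,\mathfrak m)$. Let $S\subset F$ be a measurable set with $0<\mathfrak m(S)<\infty$ such that $$\frac{1}{\mathfrak m(B(0,q^{-n}))}\int_{B(0,q^{-n})}\mathfrak m\big(S\setminus(S+y)\big)\,d\mathfrak m(y)=O(q^{-n})\qquad\text{as } n\to\infty .$$ Let $\mathcal X$ be a determinantal point process on $F$ with correlation kernel $K_S(x,y)=\widehat{\mathbf 1_S}(x-y)$; that is, $\mathcal X$ is a random locally finite subset of $F$ such that for every $n\ge 1$ and every bounded measurable compactly supported $\varphi:F^n\to\mathbb C$, $$\mathbb E\Big(\sum^{*}_{x_1,\dots,x_n\in\mathcal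 X}\varphi(x_1,\dots,x_n)\Big)=\int_{F^n}\varphi(y_1,\dots,y_n)\det\big(K_S(y_i,y_j)\big)_{1\le i,j\le n}\,d\mathfrak m(y_1)\cdots d\mathfrak m(y_n),$$ where $\sum^{*}$ is the sum over ordered $n$-tuples of distinct points of $\mathcal X$, and both sides converge absolutely. Then $\mathcal X$ is number rigid: for every bounded open set $B\subset F$, the number $\#(\mathcal X\cap B)$ is almost surely determined by $\mathcal X\setminus B$, i.e. it is almost surely equal to a measurable function of the configuration $\mathcal X\setminus B$. -/

import Mathlib

open MeasureTheory Filter Topology Asymptotics Set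
open scoped NormedField Valued Pointwise

noncomputable section

/-- The number `q` of elements of the residue field `𝒪_F / 𝓜_F`, where `𝒪_F = {x : ‖x‖ ≤ 1}` and
`𝓜_F = {x : ‖x‖ < 1}`. -/
def residueCard (F : Type*) [NontriviallyNormedField F] [IsUltrametricDist F] : ℕ :=
  Nat.card 𝓀[F]

/-- The norm of `F` is the standard one: the maximal ideal of the valuation ring is generated by
an element of norm `q⁻¹`. -/
def IsStandardNorm (F : Type*) [NontriviallyNormedField F] [IsUltrametricDist F] : Prop :=
  ∃ ϖ : F, ‖ϖ‖ = (residueCard F : ℝ)⁻¹ ∧ ∀ x : F, ‖x‖ < 1 ↔ ∃ y : F, ‖y‖ ≤ 1 ∧ x = ϖ * y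

/-- A continuous unitary character `χ` of the additive group `F` which is trivial on the valuation
ring `𝒪_F` and is not constant on `ϖ⁻¹ 𝒪_F = {x : ‖x‖ ≤ q}`. -/
structure IsConductorCharacter {F : Type*} [NontriviallyNormedField F] [IsUltrametricDist F]
    (χ : AddChar F Circle) : Prop where
  continuous : Continuous χ
  eq_one : ∀ x : F, ‖x‖ ≤ 1 → χ x = 1
  not_const : ∃ x y : F, ‖x‖ ≤ residueCard F ∧ ‖y‖ ≤ residueCard F ∧ χ x ≠ χ y

/-- The Fourier transform `f̂(y) = ∫ f(x) χ(x y) dm(x)`. -/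
def fourierTransform {F : Type*} [NontriviallyNormedField F] [MeasurableSpace F]
    (χ : AddChar F Circle) (m : Measure F) (f : F → ℂ) (y : F) : ℂ :=
  ∫ x, f x * (χ (x * y) : ℂ) ∂m

/-- The kernel `K_S(x, y) = \hat{1_S}(x - y)`. -/
def stationaryKernel {F : Type*} [NontriviallyNormedField F] [MeasurableSpace F]
    (χ : AddChar F Circle) (m : Measure F) (S : Set F) (x y : F) : ℂ :=
  fourierTransform χ m (S.indicator fun _ => 1) (x - y)

/-- Locally finite subsets of `F`: those with finitely many points in every bounded set. -/
structure Configuration (F : Type*) [PseudoMetricSpace F] where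
  /-- the underlying set of points -/
  points : Set F
  finite_inter : ∀ B : Set F, Bornology.IsBounded B → (points ∩ B).Finite

namespace Configuration

variable {F : Type*} [PseudoMetricSpace F]

/-- The configuration `X \ B`. -/
def diff (X : Configuration F) (B : Set F) : Configuration F where
  points := X.points \ B
  finite_inter := fun A hA =>
    (X.finite_inter A hA).subset (Set.inter_subset_inter_left A Set.sdiff_subset)

/-- The number `#(X ∩ B)` of points of `X` in `B`. -/
def count (B : Set F) (X : Configuration F) : ℕ∞ := (X.points ∩ B).encard

/-- The σ-algebra on configurations generated by the counts `X ↦ #(X ∩ B)`, `B` Borel. -/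
instance instMeasurableSpace [MeasurableSpace F] : MeasurableSpace (Configuration F) :=
  ⨆ B : {B : Set F // MeasurableSet B}, MeasurableSpace.comap (count B.1) ⊤

end Configuration

/-- The random locally finite set `X` is a determinantal point process with correlation kernel `K`
with respect to the measure `m`: for every `n ≥ 1` and every bounded measurable compactly supported
`φ` on `Fⁿ`,
`𝔼 ∑* φ(x₁, …, xₙ) = ∫ φ(y₁, …, yₙ) det (K(yᵢ, yⱼ)) dm(y₁) … dm(yₙ)`,
both sides being absolutely integrable, where `∑*` is the sum over the `n`-tuples of distinct
points of `X` (it has only finitely many nonzero terms). -/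
def IsDeterminantal {F Ω : Type*} [PseudoMetricSpace F] [MeasurableSpace F] [MeasurableSpace Ω]
    (P : Measure Ω) (X : Ω → Configuration F) (m : Measure F) (K : F → F → ℂ) : Prop :=
  ∀ n : ℕ, 0 < n → ∀ φ : (Fin n → F) → ℂ,
    Measurable φ → (∃ C : ℝ, ∀ x, ‖φ x‖ ≤ C) → HasCompactSupport φ →
    Integrable (fun ω => ∑ᶠ x ∈ {x : Fin n → F | Function.Injective x ∧
      ∀ i, x i ∈ (X ω).points}, φ x) P ∧
    Integrable (fun y : Fin n → F => φ y * (Matrix.of fun i j => K (y i) (y j)).det)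
      (Measure.pi fun _ => m) ∧
    ∫ ω, (∑ᶠ x ∈ {x : Fin n → F | Function.Injective x ∧ ∀ i, x i ∈ (X ω).points}, φ x) ∂P =
      ∫ y : Fin n → F, φ y * (Matrix.of fun i j => K (y i) (y j)).det ∂(Measure.pi fun _ => m)

/-- Number rigidity: for every bounded open `B`, the number of points of `X` in `B` is almost
surely equal to a measurable function of the configuration `X \ B`. -/
def IsNumberRigid {F Ω : Type*} [PseudoMetricSpace F] [MeasurableSpace F] [MeasurableSpace Ω]
    (P : Measure Ω) (X : Ω → Configuration F) : Prop :=
  ∀ B : Set F, IsOpen B → Bornology.IsBounded B →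
    ∃ N : Configuration F → ℕ∞, Measurable N ∧
      ∀ᵐ ω ∂P, (X ω).count B = N ((X ω).diff B)

end

/-!
Write `B_k` for the ball of radius `q ^ k` and `N_k = #(X ∩ B_k)`. The proof is the Ghosh–Peres
argument: it suffices to find functions that are `1` on `B` and whose linear statistics have
variances tending to `0`. Then `#(X ∩ B)` plus a sum over `X \ B`, minus a constant, tends to `0`
almost surely along a subsequence, and `#(X ∩ B)` can be read off from `X \ B`
(`exists_measurable_count_eq`).

For `k ≤ l` the ball `B_l` is invariant under translation by elements of `B_k`. With
`m (B_k) = q ^ k` (`measure_scaleBall`) the determinantal identities for one and two points give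
`Cov (N_k, N_l) = q ^ k (m S - ∫_{B_l} |K_S(u, 0)|² du)`. Since the characters `χ(a ·)` are
orthogonal to `1` on `B_l` unless `|a| ≤ q ^ (-l)`, Fubini turns the integral into the mean of
`m (S ∩ (S + y))` over `B_{-l}`, and the covariance becomes `q ^ k` times the mean of
`m (S \ (S + y))` over `B_{-l}` (`meanDefect_eq`, `IsDeterminantal.mean_count_mul_count`). By
hypothesis this is `O(q ^ (k - l))`.

A single `1_{B_k}` thus has a bounded variance only, but covariances decay geometrically in the
distance of the scales, so the average of `n` consecutive indicators `1_{B_k}` has a variance of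
order `1 / n` (`integral_sq_sum_range_le`). These averages are `1` on `B` once the smallest ball
contains `B`.
-/

/-! ### Balls of radius a power of `q`, and characters on them -/

section ScaleBalls

variable {F : Type*} [NontriviallyNormedField F] [IsUltrametricDist F]

lemma norm_sub_le_max_norm (x y : F) : ‖x - y‖ ≤ max ‖x‖ ‖y‖ := by
  simpa [sub_eq_add_neg] using IsUltrametricDist.norm_add_le_max x (-y)

variable (F) in
/-- The closed ball of radius `q ^ l` around the origin. -/
abbrev scaleBall (l : ℤ) : Set F := Metric.closedBall (0 : F) ((residueCard F : ℝ) ^ l)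

lemma IsStandardNorm.residueCard_ne_zero (hF : IsStandardNorm F) : residueCard F ≠ 0 := by
  obtain ⟨ϖ, h1, h2⟩ := hF
  intro h
  obtain ⟨x, hx0, hx1⟩ := NormedField.exists_norm_lt_one F
  obtain ⟨y, -, rfl⟩ := (h2 x).1 hx1
  simp [h] at h1
  simp [h1] at hx0

lemma IsStandardNorm.finite_residueField (hF : IsStandardNorm F) : Finite 𝓀[F] :=
  Nat.finite_of_card_ne_zero hF.residueCard_ne_zero

lemma IsStandardNorm.one_lt_residueCard (hF : IsStandardNorm F) : 1 < residueCard F := by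
  have := hF.finite_residueField
  exact Finite.one_lt_card

/-- The norm takes no value strictly between `1` and `q`. -/
lemma IsStandardNorm.le_norm_of_one_lt (hF : IsStandardNorm F) {x : F} (hx : 1 < ‖x‖) :
    (residueCard F : ℝ) ≤ ‖x‖ := by
  have hq := hF.one_lt_residueCard
  obtain ⟨ϖ, h1, h2⟩ := hF
  obtain ⟨y, hy, h⟩ := (h2 x⁻¹).1 (by rw [norm_inv]; exact inv_lt_one_of_one_lt₀ hx)
  have h3 : ‖x‖⁻¹ ≤ (residueCard F : ℝ)⁻¹ := by
    rw [← norm_inv, h, norm_mul, h1]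
    exact mul_le_of_le_one_right (by positivity) hy
  exact (inv_le_inv₀ (by positivity) (by positivity)).1 h3

lemma scaleBall_mono (hF : IsStandardNorm F) {k l : ℤ} (h : k ≤ l) :
    scaleBall F k ⊆ scaleBall F l :=
  Metric.closedBall_subset_closedBall
    (zpow_le_zpow_right₀ (by exact_mod_cast hF.one_lt_residueCard.le) h)

lemma neg_mem_scaleBall_iff {l : ℤ} {x : F} : -x ∈ scaleBall F l ↔ x ∈ scaleBall F l := by
  simp

lemma sub_mem_scaleBall {l : ℤ} {x y : F} (hx : x ∈ scaleBall F l) (hy : y ∈ scaleBall F l) :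
    x - y ∈ scaleBall F l := by
  rw [mem_closedBall_zero_iff] at *
  exact (norm_sub_le_max_norm x y).trans (max_le hx hy)

lemma sub_mem_scaleBall_iff {l : ℤ} {x y : F} (hx : x ∈ scaleBall F l) :
    x - y ∈ scaleBall F l ↔ y ∈ scaleBall F l :=
  ⟨fun h => by simpa using sub_mem_scaleBall hx h, sub_mem_scaleBall hx⟩

variable {χ : AddChar F Circle}

/-- The dilated character `u ↦ χ (a u)` is nontrivial on every ball on which `|a u|` exceeds `1`
somewhere: its maximum is then at least `q`, and `χ` is nontrivial on the ball of radius `q`. -/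
lemma IsConductorCharacter.exists_ne_one (hF : IsStandardNorm F) (hχ : IsConductorCharacter χ)
    {a : F} {l : ℤ} (ha : (residueCard F : ℝ) ^ (-l) < ‖a‖) :
    ∃ u ∈ scaleBall F l, χ (a * u) ≠ 1 := by
  have hq0 : (0 : ℝ) < residueCard F := by exact_mod_cast hF.one_lt_residueCard.le
  have ha0 : 0 < ‖a‖ := lt_trans (by positivity) ha
  obtain ⟨z, hz, hz1⟩ : ∃ z : F, ‖z‖ ≤ residueCard F ∧ χ z ≠ 1 := by
    obtain ⟨x, y, hx, hy, hxy⟩ := hχ.not_const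
    by_contra! h
    exact hxy ((h x hx).trans (h y hy).symm)
  refine ⟨a⁻¹ * z, ?_, by rwa [mul_inv_cancel_left₀ (norm_pos_iff.1 ha0)]⟩
  have hϖ : ∃ p : F, ‖p‖ = (residueCard F : ℝ) ^ l := by
    obtain ⟨ϖ, h1, -⟩ := hF
    exact ⟨ϖ ^ (-l), by rw [norm_zpow, h1, inv_zpow', neg_neg]⟩
  obtain ⟨p, hp⟩ := hϖ
  have h2 : 1 < ‖a * p‖ := by
    rw [norm_mul, hp]
    rwa [zpow_neg, inv_lt_iff_one_lt_mul₀ (by positivity)] at ha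
  have h3 := hF.le_norm_of_one_lt h2
  rw [norm_mul, hp] at h3
  rw [mem_closedBall_zero_iff, norm_mul, norm_inv, inv_mul_le_iff₀ ha0]
  exact hz.trans h3

variable [MeasurableSpace F] [BorelSpace F]

/-- The ball of radius `q ^ (l + 1)` is the disjoint union of `q` translates of the ball of
radius `q ^ l`, indexed by the residue field. -/
lemma measure_scaleBall_succ (hF : IsStandardNorm F) (m : Measure F) [m.IsAddHaarMeasure]
    (l : ℤ) : m (scaleBall F (l + 1)) = residueCard F * m (scaleBall F l) := by
  have hq := hF.one_lt_residueCard
  have hq0 : (0 : ℝ) < residueCard F := by positivity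
  have := hF.finite_residueField
  obtain ⟨ϖ, h1, h2⟩ := hF
  have hϖ0 : ϖ ≠ 0 := by
    rintro rfl
    simp at h1
    exact hq0.ne h1
  have hϖl : ∀ n : ℤ, ‖ϖ ^ n‖ = (residueCard F : ℝ) ^ (-n) := fun n => by
    rw [norm_zpow, h1, inv_zpow']
  have key : ∀ a b : 𝒪[F], IsLocalRing.residue 𝒪[F] a = IsLocalRing.residue 𝒪[F] b ↔
      ‖(a : F) - b‖ < 1 := by
    intro a b
    rw [← sub_eq_zero, ← map_sub, IsLocalRing.residue_eq_zero_iff, IsLocalRing.mem_maximalIdeal,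
      mem_nonunits_iff, Valued.integer.isUnit_iff_norm_eq_one]
    exact (lt_iff_le_and_ne.trans (and_iff_right (Valued.integer.norm_le_one (a - b)))).symm
  have key2 : ∀ x : F, ‖x‖ < 1 ↔ ‖x‖ ≤ (residueCard F : ℝ)⁻¹ := by
    intro x
    refine ⟨fun h => ?_, fun h => h.trans_lt (inv_lt_one_of_one_lt₀ (by exact_mod_cast hq))⟩
    obtain ⟨y, hy, rfl⟩ := (h2 x).1 h
    rw [norm_mul, h1]
    exact mul_le_of_le_one_right (by positivity) hy
  choose lift hlift using IsLocalRing.residue_surjective (R := 𝒪[F])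
  let g : 𝓀[F] → F := fun r => ϖ ^ (-(l + 1)) * lift r
  have hmem : ∀ r x, x ∈ (g r) +ᵥ scaleBall F l ↔ ‖ϖ ^ (l + 1) * x - lift r‖ < 1 := by
    intro r x
    rw [Set.mem_vadd_set_iff_neg_vadd_mem, vadd_eq_add, mem_closedBall_zero_iff, key2]
    have : ϖ ^ (l + 1) * x - lift r = ϖ ^ (l + 1) * (-g r + x) := by
      simp only [g, zpow_neg]
      field_simp
      ring
    rw [this, norm_mul, hϖl, zpow_neg, inv_mul_le_iff₀ (by positivity), zpow_add₀ hq0.ne', zpow_one,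
      mul_inv_cancel_right₀ hq0.ne']
  have hU : scaleBall F (l + 1) = ⋃ r, (g r) +ᵥ scaleBall F l := by
    ext x
    simp only [mem_iUnion, hmem, mem_closedBall_zero_iff]
    have h3 : ‖x‖ ≤ (residueCard F : ℝ) ^ (l + 1) ↔ ‖ϖ ^ (l + 1) * x‖ ≤ 1 := by
      rw [norm_mul, hϖl, zpow_neg, inv_mul_le_iff₀ (by positivity), mul_one]
    rw [h3]
    constructor
    · intro h
      refine ⟨IsLocalRing.residue 𝒪[F] ⟨_, Valued.integer.mem_iff.2 h⟩, ?_⟩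
      exact (key ⟨_, Valued.integer.mem_iff.2 h⟩ _).1 (hlift _).symm
    · rintro ⟨r, hr⟩
      have := IsUltrametricDist.norm_add_le_max (ϖ ^ (l + 1) * x - lift r) (lift r)
      rw [sub_add_cancel] at this
      exact this.trans (max_le hr.le (Valued.integer.norm_le_one _))
  have hD : Pairwise (Function.onFun Disjoint fun r => (g r) +ᵥ scaleBall F l) := by
    intro r s hrs
    refine Set.disjoint_left.2 fun x hr hs => hrs ?_
    rw [hmem] at hr hs
    rw [← hlift r, ← hlift s, key]
    have := norm_sub_le_max_norm (ϖ ^ (l + 1) * x - lift s) (ϖ ^ (l + 1) * x - lift r)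
    rw [sub_sub_sub_cancel_left] at this
    exact this.trans_lt (max_lt hs hr)
  rw [hU, measure_iUnion hD fun r => (Metric.isClosed_closedBall.measurableSet.const_vadd _)]
  simp only [measure_vadd]
  rw [ENNReal.tsum_const]
  simp [residueCard, ENat.card_eq_coe_natCard]

lemma measure_scaleBall (hF : IsStandardNorm F) (m : Measure F) [m.IsAddHaarMeasure]
    (hm : m (Metric.closedBall 0 1) = 1) (l : ℤ) :
    m.real (scaleBall F l) = (residueCard F : ℝ) ^ l := by
  have hq0 : (residueCard F : ℝ) ≠ 0 := by exact_mod_cast hF.residueCard_ne_zero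
  have h1 : ∀ l : ℤ, m.real (scaleBall F (l + 1)) = residueCard F * m.real (scaleBall F l) := by
    intro l
    simp [measureReal_def, measure_scaleBall_succ hF m l]
  induction l with
  | zero => rw [measureReal_def, scaleBall, zpow_zero, hm, ENNReal.toReal_one]
  | succ i ih => rw [h1, ih, zpow_add_one₀ hq0, mul_comm]
  | pred i ih =>
    have h := h1 (-(i : ℤ) - 1)
    rw [sub_add_cancel, ih] at h
    rw [zpow_sub_one₀ hq0, h, mul_comm, inv_mul_cancel_left₀ hq0]

/-- Orthogonality of characters on the compact group `scaleBall F l`. -/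
lemma IsConductorCharacter.setIntegral_scaleBall (hF : IsStandardNorm F)
    (hχ : IsConductorCharacter χ) (m : Measure F) [m.IsAddHaarMeasure]
    (hm : m (Metric.closedBall 0 1) = 1) (l : ℤ) (a : F) :
    ∫ u in scaleBall F l, (χ (a * u) : ℂ) ∂m =
      (residueCard F : ℂ) ^ l * (scaleBall F (-l)).indicator (fun _ => 1) a := by
  have hq0 : (0 : ℝ) < residueCard F := by exact_mod_cast hF.one_lt_residueCard.le
  by_cases ha : a ∈ scaleBall F (-l)
  · rw [indicator_of_mem ha, mul_one]
    rw [mem_closedBall_zero_iff] at ha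
    rw [setIntegral_congr_fun (g := fun _ => (1 : ℂ)) Metric.isClosed_closedBall.measurableSet]
    · rw [setIntegral_const, measure_scaleBall hF m hm]
      simp
    · intro u hu
      rw [mem_closedBall_zero_iff] at hu
      have : ‖a * u‖ ≤ 1 := by
        rw [norm_mul]
        calc ‖a‖ * ‖u‖ ≤ (residueCard F : ℝ) ^ (-l) * (residueCard F : ℝ) ^ l := by gcongr
          _ = 1 := by rw [← zpow_add₀ hq0.ne']; simp
      simp [hχ.eq_one _ this]
  · rw [indicator_of_notMem ha, mul_zero]
    rw [mem_closedBall_zero_iff, not_le] at ha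
    obtain ⟨v, hv, hv1⟩ := hχ.exists_ne_one hF ha
    have h1 : ∫ u in scaleBall F l, (χ (a * u) : ℂ) ∂m =
        χ (a * v) * ∫ u in scaleBall F l, (χ (a * u) : ℂ) ∂m := by
      rw [← integral_indicator Metric.isClosed_closedBall.measurableSet, ← integral_const_mul]
      rw [← integral_add_left_eq_self _ v]
      refine integral_congr_ae (.of_forall fun u => ?_)
      have h : v + u ∈ scaleBall F l ↔ u ∈ scaleBall F l := by
        rw [← sub_mem_scaleBall_iff hv, sub_add_cancel_left, neg_mem_scaleBall_iff]
      by_cases hu : u ∈ scaleBall F l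
      · simp [indicator_of_mem hu, indicator_of_mem (h.2 hu), mul_add, AddChar.map_add_eq_mul]
      · simp [indicator_of_notMem hu, indicator_of_notMem (mt h.1 hu)]
    have h2 : ((χ (a * v) : ℂ) - 1) * ∫ u in scaleBall F l, (χ (a * u) : ℂ) ∂m = 0 := by
      rw [sub_mul, one_mul, ← h1, sub_self]
    refine (mul_eq_zero.1 h2).resolve_left fun h => hv1 ?_
    exact Subtype.ext (sub_eq_zero.1 h)

end ScaleBalls

/-! ### Autocorrelation of `S` and the energy of the kernel -/

section Defect

variable {F : Type*} [MeasurableSpace F] {m : Measure F} {S : Set F}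

lemma integrable_indicator_one (hS : MeasurableSet S) (hS1 : m S ≠ ⊤) :
    Integrable (S.indicator fun _ => (1 : ℝ)) m :=
  (integrableOn_const hS1).integrable_indicator hS

variable [NontriviallyNormedField F] {χ : AddChar F Circle}

lemma stationaryKernel_congr {T : Set F} (h : S =ᵐ[m] T) :
    stationaryKernel χ m S = stationaryKernel χ m T := by
  ext x y
  refine integral_congr_ae ?_
  filter_upwards [indicator_ae_eq_of_ae_eq_set (f := fun _ => (1 : ℂ)) h] with t ht
  rw [ht]

lemma stationaryKernel_self (hS : MeasurableSet S) (x : F) :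
    stationaryKernel χ m S x x = m.real S := by
  simp [stationaryKernel, fourierTransform, integral_indicator hS]

lemma integral_indicator_mul_translate [BorelSpace F] [m.IsAddHaarMeasure]
    (hS : MeasurableSet S) (y : F) :
    ∫ t, S.indicator (fun _ => (1 : ℝ)) t * S.indicator (fun _ => (1 : ℝ)) (t + y) ∂m =
      m.real (S ∩ ((fun s => s + y) '' S)) := by
  have h2 : MeasurableSet (S ∩ ((fun s => s + y) '' S)) :=
    hS.inter ((Homeomorph.addRight y).measurableEmbedding.measurableSet_image.2 hS)
  rw [← integral_indicator_one h2,
    ← integral_add_right_eq_self ((S ∩ ((fun s => s + y) '' S)).indicator 1) y]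
  congr 1 with t
  have h : t + y ∈ S ∩ ((fun s => s + y) '' S) ↔ t ∈ S ∧ t + y ∈ S := by simp [and_comm]
  classical
  simp only [indicator_apply, h, Pi.one_apply]
  by_cases ht : t ∈ S <;> by_cases ht' : t + y ∈ S <;> simp [ht, ht']

variable [IsUltrametricDist F]

/-- The mean of `m (S \ (S + y))` over the ball of radius `q ^ n`. -/
noncomputable def meanDefect (m : Measure F) (S : Set F) (n : ℤ) : ℝ :=
  ⨍ y in scaleBall F n, m.real (S \ ((fun s => s + y) '' S)) ∂m

variable [BorelSpace F] [m.IsAddHaarMeasure]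

lemma meanDefect_congr {T : Set F} (h : S =ᵐ[m] T) (n : ℤ) :
    meanDefect m S n = meanDefect m T n := by
  unfold meanDefect
  congr 1 with y
  refine measureReal_congr (h.diff ?_)
  have e : ∀ A : Set F, (fun s => s + y) '' A = (fun s => s + -y) ⁻¹' A := fun A => by
    ext; simp
  rw [e, e]
  exact (measurePreserving_add_right m (-y)).quasiMeasurePreserving.preimage_ae_eq h

end Defect

section Autocorrelation

variable {F : Type*} [NontriviallyNormedField F] [ProperSpace F] [MeasurableSpace F]
  {m : Measure F} [m.IsAddHaarMeasure]
  {χ : AddChar F Circle} {S : Set F}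

lemma fourierTransform_mul_neg (y : F) :
    fourierTransform χ m (S.indicator fun _ => 1) y *
      fourierTransform χ m (S.indicator fun _ => 1) (-y) =
    ∫ p : F × F, S.indicator (fun _ => (1 : ℂ)) p.1 * S.indicator (fun _ => 1) p.2 *
      χ ((p.1 - p.2) * y) ∂(m.prod m) := by
  rw [fourierTransform, fourierTransform, ← integral_prod_mul]
  congr 1 with p
  rw [show (p.1 - p.2) * y = p.1 * y + p.2 * -y by ring, AddChar.map_add_eq_mul, Circle.coe_mul]
  ring

variable [BorelSpace F] [IsUltrametricDist F]

lemma integrable_indicator_mul_translate (hS : MeasurableSet S) (hS1 : m S ≠ ⊤) (l : ℤ) :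
    Integrable (fun p : F × F => S.indicator (fun _ => (1 : ℝ)) p.1 *
      S.indicator (fun _ => (1 : ℝ)) (p.1 + p.2)) (m.prod (m.restrict (scaleBall F l))) := by
  have : Fact (m (scaleBall F l) < ⊤) := ⟨measure_closedBall_lt_top⟩
  have h1 : Integrable (fun p : F × F => S.indicator (fun _ => (1 : ℝ)) p.1 * (1 : ℝ))
      (m.prod (m.restrict (scaleBall F l))) :=
    (integrable_indicator_one hS hS1).mul_prod (integrable_const 1)
  have hg : Measurable (S.indicator fun _ => (1 : ℝ)) := measurable_const.indicator hS
  refine h1.mono (by fun_prop) (.of_forall fun p => ?_)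
  rw [norm_mul, norm_mul]
  gcongr
  by_cases h : p.1 + p.2 ∈ S <;> simp [h]

/-- Substituting `s = t + y` in `∬ 1_S(s) 1_S(t) 1_B(s - t)`. -/
lemma integral_overlap (hS : MeasurableSet S) (hS1 : m S ≠ ⊤) (l : ℤ) :
    ∫ y in scaleBall F l, m.real (S ∩ ((fun s => s + y) '' S)) ∂m =
      ∫ t, ∫ s, S.indicator (fun _ => (1 : ℝ)) s * S.indicator (fun _ => (1 : ℝ)) t *
        (scaleBall F l).indicator (fun _ => 1) (s - t) ∂m ∂m := by
  simp_rw [← integral_indicator_mul_translate (m := m) hS]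
  rw [← integral_integral_swap (integrable_indicator_mul_translate hS hS1 l)]
  congr 1 with t
  rw [← integral_indicator Metric.isClosed_closedBall.measurableSet,
    ← integral_add_left_eq_self (fun s => S.indicator (fun _ => (1 : ℝ)) s *
      S.indicator (fun _ => (1 : ℝ)) t * (scaleBall F l).indicator (fun _ => 1) (s - t)) t]
  congr 1 with y
  rw [add_sub_cancel_left]
  by_cases hy : y ∈ scaleBall F l
  · simp only [indicator_of_mem hy, mul_one]
    exact mul_comm _ _
  · simp only [indicator_of_notMem hy, mul_zero]

lemma integrable_overlap (hS : MeasurableSet S) (hS1 : m S ≠ ⊤) (l : ℤ) :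
    IntegrableOn (fun y => m.real (S ∩ ((fun s => s + y) '' S))) (scaleBall F l) m := by
  simp_rw [← integral_indicator_mul_translate (m := m) hS]
  exact (integrable_indicator_mul_translate hS hS1 l).integral_prod_right

lemma integrable_character_mul_indicator (hχ : IsConductorCharacter χ)
    (hS : MeasurableSet S) (hS1 : m S ≠ ⊤) (l : ℤ) :
    Integrable (Function.uncurry fun (u : F) (p : F × F) =>
      S.indicator (fun _ => (1 : ℂ)) p.1 * S.indicator (fun _ => 1) p.2 * χ ((p.1 - p.2) * u))
      ((m.restrict (scaleBall F l)).prod (m.prod m)) := by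
  have : Fact (m (scaleBall F l) < ⊤) := ⟨measure_closedBall_lt_top⟩
  have hg : Measurable (S.indicator fun _ => (1 : ℂ)) := measurable_const.indicator hS
  have hgi : Integrable (S.indicator fun _ => (1 : ℂ)) m :=
    (integrableOn_const hS1).integrable_indicator hS
  have hgg : Integrable (fun p : F × F => S.indicator (fun _ => (1 : ℂ)) p.1 *
      S.indicator (fun _ => 1) p.2) (m.prod m) := hgi.mul_prod hgi
  have h1 : Integrable (fun z : F × F × F => (1 : ℂ) * (S.indicator (fun _ => (1 : ℂ)) z.2.1 *
    S.indicator (fun _ => 1) z.2.2)) ((m.restrict (scaleBall F l)).prod (m.prod m)) :=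
    (integrable_const (1 : ℂ)).mul_prod hgg
  have hc : Continuous fun z : F × F × F => (χ ((z.2.1 - z.2.2) * z.1) : ℂ) :=
    continuous_subtype_val.comp (hχ.continuous.comp (by fun_prop))
  refine h1.mono ?_ (.of_forall fun z => ?_)
  · have := hc.measurable
    exact Measurable.aestronglyMeasurable (by unfold Function.uncurry; fun_prop)
  · simp only [Function.uncurry, norm_mul, Circle.norm_coe, mul_one, one_mul, le_refl]

lemma integrableOn_fourierTransform_mul_neg (hχ : IsConductorCharacter χ)
    (hS : MeasurableSet S) (hS1 : m S ≠ ⊤) (l : ℤ) :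
    IntegrableOn (fun u => fourierTransform χ m (S.indicator fun _ => 1) u *
      fourierTransform χ m (S.indicator fun _ => 1) (-u)) (scaleBall F l) m := by
  simp_rw [fourierTransform_mul_neg]
  exact (integrable_character_mul_indicator hχ hS hS1 l).integral_prod_left

/-- The Fubini computation behind the Plancherel formula: the energy of `K_S` in a large ball is
the autocorrelation of `S` over the dual small ball. -/
lemma setIntegral_fourierTransform_mul_neg (hF : IsStandardNorm F)
    (hm : m (Metric.closedBall 0 1) = 1) (hχ : IsConductorCharacter χ)
    (hS : MeasurableSet S) (hS1 : m S ≠ ⊤) (l : ℤ) :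
    ∫ u in scaleBall F l, fourierTransform χ m (S.indicator fun _ => 1) u *
      fourierTransform χ m (S.indicator fun _ => 1) (-u) ∂m =
    (residueCard F : ℂ) ^ l *
      ((∫ y in scaleBall F (-l), m.real (S ∩ ((fun s => s + y) '' S)) ∂m : ℝ) : ℂ) := by
  have hg : Measurable (S.indicator fun _ => (1 : ℂ)) := measurable_const.indicator hS
  have hgi : Integrable (S.indicator fun _ => (1 : ℂ)) m :=
    (integrableOn_const hS1).integrable_indicator hS
  have hgg : Integrable (fun p : F × F => S.indicator (fun _ => (1 : ℂ)) p.1 *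
      S.indicator (fun _ => 1) p.2) (m.prod m) := hgi.mul_prod hgi
  simp_rw [fourierTransform_mul_neg]
  rw [integral_integral_swap (integrable_character_mul_indicator hχ hS hS1 l)]
  have hB : MeasurableSet (scaleBall F (-l)) := Metric.isClosed_closedBall.measurableSet
  have hinner : ∀ p : F × F, ∫ u in scaleBall F l, S.indicator (fun _ => (1 : ℂ)) p.1 *
      S.indicator (fun _ => 1) p.2 * χ ((p.1 - p.2) * u) ∂m =
      (residueCard F : ℂ) ^ l * (S.indicator (fun _ => 1) p.1 * S.indicator (fun _ => 1) p.2 *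
        (scaleBall F (-l)).indicator (fun _ => 1) (p.1 - p.2)) := fun p => by
    rw [integral_const_mul, hχ.setIntegral_scaleBall hF m hm]
    ring
  simp_rw [hinner]
  rw [integral_const_mul, integral_overlap hS hS1]
  congr 1
  rw [integral_prod_symm]
  · rw [← integral_complex_ofReal]
    congr 1 with t
    rw [← integral_complex_ofReal]
    congr 1 with s
    classical
    simp only [indicator_apply]
    split_ifs <;> simp
  · refine hgg.mono ?_ (.of_forall fun p => ?_)
    · have : Measurable ((scaleBall F (-l)).indicator fun _ => (1 : ℂ)) :=
        measurable_const.indicator Metric.isClosed_closedBall.measurableSet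
      exact Measurable.aestronglyMeasurable (by fun_prop)
    · rw [norm_mul]
      refine mul_le_of_le_one_right (norm_nonneg _) ?_
      classical
      simp only [indicator_apply]
      split_ifs <;> simp

/-- The mean defect at scale `q ^ (-l)` is the mass that `|K_S|²` has outside the ball of radius
`q ^ l`, since the total mass is `m S` by Plancherel. Only the mass inside the ball enters here. -/
lemma meanDefect_eq (hF : IsStandardNorm F) (hm : m (Metric.closedBall 0 1) = 1)
    (hχ : IsConductorCharacter χ) (hS : MeasurableSet S) (hS1 : m S ≠ ⊤) (l : ℤ) :
    (meanDefect m S (-l) : ℂ) = m.real S -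
      ∫ u in scaleBall F l, fourierTransform χ m (S.indicator fun _ => 1) u *
        fourierTransform χ m (S.indicator fun _ => 1) (-u) ∂m := by
  have hq0 : (residueCard F : ℝ) ≠ 0 := by exact_mod_cast hF.residueCard_ne_zero
  have h1 : ∀ y, m.real (S \ ((fun s => s + y) '' S)) =
      m.real S - m.real (S ∩ ((fun s => s + y) '' S)) := by
    intro y
    have h2 : MeasurableSet ((fun s => s + y) '' S) :=
      (Homeomorph.addRight y).measurableEmbedding.measurableSet_image.2 hS
    rw [eq_sub_iff_add_eq, measureReal_sdiff_add_inter h2 hS1]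
  rw [setIntegral_fourierTransform_mul_neg hF hm hχ hS hS1, meanDefect, setAverage_eq]
  simp_rw [h1]
  have : Fact (m (scaleBall F (-l)) < ⊤) := ⟨measure_closedBall_lt_top⟩
  rw [integral_sub (integrable_const _) (integrable_overlap hS hS1 _), setIntegral_const,
    measure_scaleBall hF m hm, smul_eq_mul, smul_eq_mul, mul_sub,
    inv_mul_cancel_left₀ (zpow_ne_zero _ hq0), zpow_neg, inv_inv]
  push_cast
  rfl

end Autocorrelation

/-! ### Counting tuples of distinct points -/

section Counting

variable {α : Type*}

lemma finsum_mem_indicator_one {T U : Set α} (h : (T ∩ U).Finite) :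
    ∑ᶠ x ∈ T, U.indicator (fun _ => (1 : ℂ)) x = ((T ∩ U).ncard : ℂ) := by
  classical
  rw [finsum_mem_def, Set.indicator_indicator, ← finsum_mem_def,
    finsum_mem_eq_finite_toFinset_sum _ h, Set.ncard_eq_toFinset_card _ h]
  simp

/-- The `n`-tuples of distinct elements of `A`. -/
def injTuples (n : ℕ) (A : Set α) : Set (Fin n → α) :=
  {x | Function.Injective x ∧ ∀ i, x i ∈ A}

lemma finite_injTuples_inter {n : ℕ} {A : Set α} {B : Fin n → Set α}
    (h : ∀ i, (A ∩ B i).Finite) : (injTuples n A ∩ Set.pi univ B).Finite :=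
  (Set.Finite.pi' h).subset fun _ hx i => ⟨hx.1.2 i, hx.2 i (mem_univ i)⟩

lemma ncard_injTuples_one (A B : Set α) :
    (injTuples 1 A ∩ Set.pi univ fun _ => B).ncard = (A ∩ B).ncard := by
  rw [← ncard_image_of_injective (A ∩ B) (f := fun a (_ : Fin 1) => a)
    fun a b h => congrFun h 0]
  congr 1
  ext x
  constructor
  · rintro ⟨⟨-, h⟩, h'⟩
    exact ⟨x 0, ⟨h 0, h' 0 (mem_univ 0)⟩, funext fun i => by rw [Subsingleton.elim i 0]⟩
  · rintro ⟨a, ha, rfl⟩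
    exact ⟨⟨Function.injective_of_subsingleton _, fun _ => ha.1⟩, fun _ _ => ha.2⟩

lemma ncard_injTuples_two {A B C : Set α} (hBC : B ⊆ C) (hC : (A ∩ C).Finite) :
    (injTuples 2 A ∩ Set.pi univ ![B, C]).ncard + (A ∩ B).ncard =
      (A ∩ B).ncard * (A ∩ C).ncard := by
  have hB : (A ∩ B).Finite := hC.subset (inter_subset_inter_right A hBC)
  have hsub : (fun a => (a, a)) '' (A ∩ B) ⊆ (A ∩ B) ×ˢ (A ∩ C) := by
    rintro _ ⟨a, ha, rfl⟩
    exact ⟨ha, ha.1, hBC ha.2⟩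
  rw [← ncard_prod, ← ncard_sdiff_add_ncard_of_subset hsub (hB.prod hC),
    ncard_image_of_injective (A ∩ B) fun a b h => congrArg Prod.fst h]
  congr 1
  rw [← ncard_image_of_injective _ (finTwoArrowEquiv α).symm.injective]
  congr 1
  ext x
  constructor
  · rintro ⟨⟨hi, h⟩, h'⟩
    refine ⟨(x 0, x 1), ⟨⟨⟨h 0, h' 0 (mem_univ 0)⟩, ⟨h 1, h' 1 (mem_univ 1)⟩⟩, ?_⟩,
      (finTwoArrowEquiv α).symm_apply_apply x⟩
    rintro ⟨a, -, ha⟩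
    have h01 := congrArg Prod.fst ha
    have h02 := congrArg Prod.snd ha
    exact zero_ne_one (hi (h01.symm.trans h02))
  · rintro ⟨⟨a, b⟩, ⟨⟨ha, hb⟩, hab⟩, rfl⟩
    have hne : a ≠ b := by
      rintro rfl
      exact hab ⟨a, ha, rfl⟩
    refine ⟨⟨?_, ?_⟩, ?_⟩
    · intro i j hij
      fin_cases i <;> fin_cases j <;> simp_all [finTwoArrowEquiv]
    · intro i
      fin_cases i
      exacts [ha.1, hb.1]
    · intro i _
      fin_cases i
      exacts [ha.2, hb.2]

end Counting

/-! ### First and second moments of the numbers of points in balls -/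

/-- The number of points of `Y` in a bounded set `B`, as a real number. -/
noncomputable def Configuration.realCount {F : Type*} [PseudoMetricSpace F] (B : Set F)
    (Y : Configuration F) : ℝ :=
  (Y.points ∩ B).ncard

lemma Configuration.measurable_realCount {F : Type*} [PseudoMetricSpace F] [MeasurableSpace F]
    {B : Set F} (hB : MeasurableSet B) :
    Measurable (Configuration.realCount B : Configuration F → ℝ) := by
  have h1 : Measurable (Configuration.count B : Configuration F → ℕ∞) :=
    Measurable.of_comap_le (le_iSup_of_le (⟨B, hB⟩ : {B : Set F // MeasurableSet B}) le_rfl)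
  have h2 : Measurable fun n : ℕ∞ => (n.toNat : ℝ) := measurable_from_top
  exact h2.comp h1

section Moments

variable {F : Type*} [NontriviallyNormedField F]
  [MeasurableSpace F] [BorelSpace F] {m : Measure F}
  {χ : AddChar F Circle} {S : Set F} {Ω : Type*} [MeasurableSpace Ω] {P : Measure Ω}
  {X : Ω → Configuration F}

/-- The factorial moment of a product of compact sets: the defining identity for its indicator. -/
lemma IsDeterminantal.factorialMoment [SigmaFinite m] {K : F → F → ℂ}
    (hdet : IsDeterminantal P X m K) {n : ℕ} (hn : 0 < n) {B : Fin n → Set F}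
    (hB : ∀ i, IsCompact (B i)) :
    Integrable (fun ω => ((injTuples n (X ω).points ∩ Set.pi univ B).ncard : ℝ)) P ∧
    IntegrableOn (fun y : Fin n → F => (Matrix.of fun i j => K (y i) (y j)).det)
      (Set.pi univ B) (Measure.pi fun _ => m) ∧
    ((∫ ω, ((injTuples n (X ω).points ∩ Set.pi univ B).ncard : ℝ) ∂P : ℝ) : ℂ) =
      ∫ y in Set.pi univ B, (Matrix.of fun i j => K (y i) (y j)).det ∂(Measure.pi fun _ => m) := by
  have hU : MeasurableSet (Set.pi univ B) := .univ_pi fun i => (hB i).measurableSet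
  obtain ⟨h1, h2, h3⟩ := hdet n hn ((Set.pi univ B).indicator fun _ => 1)
    (measurable_const.indicator hU)
    ⟨1, fun x => by classical rw [indicator_apply]; split_ifs <;> simp⟩
    (.intro (isCompact_univ_pi hB) fun x hx => indicator_of_notMem hx _)
  have e1 : ∀ ω, ∑ᶠ x ∈ {x : Fin n → F | Function.Injective x ∧ ∀ i, x i ∈ (X ω).points},
      (Set.pi univ B).indicator (fun _ => (1 : ℂ)) x =
      (((injTuples n (X ω).points ∩ Set.pi univ B).ncard : ℝ) : ℂ) := fun ω => by
    rw [Complex.ofReal_natCast]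
    exact finsum_mem_indicator_one
      (finite_injTuples_inter fun i => (X ω).finite_inter _ (hB i).isBounded)
  have e2 : (fun y : Fin n → F => (Set.pi univ B).indicator (fun _ => (1 : ℂ)) y *
      (Matrix.of fun i j => K (y i) (y j)).det) = (Set.pi univ B).indicator fun y =>
      (Matrix.of fun i j => K (y i) (y j)).det := by
    ext y
    by_cases hy : y ∈ Set.pi univ B
    · rw [indicator_of_mem hy, indicator_of_mem hy, one_mul]
    · rw [indicator_of_notMem hy, indicator_of_notMem hy, zero_mul]
  simp only [e1] at h1 h3
  rw [e2] at h2 h3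
  rw [integral_complex_ofReal, integral_indicator hU] at h3
  exact ⟨by simpa using h1.re, (integrable_indicator_iff hU).1 h2, h3⟩

variable [IsUltrametricDist F] [ProperSpace F] [m.IsAddHaarMeasure]

lemma IsDeterminantal.mean_count (hF : IsStandardNorm F) (hm : m (Metric.closedBall 0 1) = 1)
    (hS : MeasurableSet S) (hdet : IsDeterminantal P X m (stationaryKernel χ m S)) (k : ℤ) :
    Integrable (fun ω => (X ω).realCount (scaleBall F k)) P ∧
    ∫ ω, (X ω).realCount (scaleBall F k) ∂P = (residueCard F : ℝ) ^ k * m.real S := by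
  obtain ⟨h1, -, h3⟩ := hdet.factorialMoment one_pos (B := fun _ => scaleBall F k)
    fun _ => isCompact_closedBall _ _
  simp only [ncard_injTuples_one] at h1 h3
  refine ⟨h1, ?_⟩
  rw [← Complex.ofReal_inj]
  refine h3.trans ?_
  simp only [Matrix.det_unique, Matrix.of_apply, stationaryKernel_self hS]
  rw [setIntegral_const, measureReal_def, Measure.pi_pi, Fin.prod_univ_one, ← measureReal_def,
    measure_scaleBall hF m hm]
  simp

/-- For `k ≤ l` the covariance of the numbers of points in the balls of radii `q ^ k` and `q ^ l` is
`q ^ k` times the mean defect of `S` at scale `q ^ (-l)`. -/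
lemma IsDeterminantal.mean_count_mul_count (hF : IsStandardNorm F)
    (hm : m (Metric.closedBall 0 1) = 1) (hχ : IsConductorCharacter χ)
    (hS : MeasurableSet S) (hS1 : m S ≠ ⊤)
    (hdet : IsDeterminantal P X m (stationaryKernel χ m S)) {k l : ℤ} (hkl : k ≤ l) :
    Integrable (fun ω => (X ω).realCount (scaleBall F k) * (X ω).realCount (scaleBall F l)) P ∧
    ∫ ω, (X ω).realCount (scaleBall F k) * (X ω).realCount (scaleBall F l) ∂P =
      ((residueCard F : ℝ) ^ k * m.real S) * ((residueCard F : ℝ) ^ l * m.real S) +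
        (residueCard F : ℝ) ^ k * meanDefect m S (-l) := by
  have hball : ∀ n, MeasurableSet (scaleBall F n) :=
    fun _ => Metric.isClosed_closedBall.measurableSet
  obtain ⟨h1, h2, h3⟩ := hdet.factorialMoment two_pos (B := ![scaleBall F k, scaleBall F l])
    (by intro i; fin_cases i <;> exact isCompact_closedBall _ _)
  obtain ⟨i1, e1⟩ := hdet.mean_count hF hm hS k
  have hcount : ∀ ω, (X ω).realCount (scaleBall F k) * (X ω).realCount (scaleBall F l) =
      ((injTuples 2 (X ω).points ∩ Set.pi univ ![scaleBall F k, scaleBall F l]).ncard : ℝ) +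
        (X ω).realCount (scaleBall F k) := fun ω => by
    have := ncard_injTuples_two (A := (X ω).points) (scaleBall_mono hF hkl)
      ((X ω).finite_inter _ Metric.isBounded_closedBall)
    simp only [Configuration.realCount]
    exact_mod_cast this.symm
  simp only [hcount]
  refine ⟨h1.add i1, ?_⟩
  rw [integral_add h1 i1, e1, ← Complex.ofReal_inj, Complex.ofReal_add, h3]
  let G : F → ℂ := fun u => (m.real S : ℂ) * m.real S -
    fourierTransform χ m (S.indicator fun _ => 1) u *
      fourierTransform χ m (S.indicator fun _ => 1) (-u)
  have hdet2 : ∀ y : Fin 2 → F,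
      (Matrix.of fun i j => stationaryKernel χ m S (y i) (y j)).det = G (y 1 - y 0) := fun y => by
    simp only [Matrix.det_fin_two, Matrix.of_apply, stationaryKernel_self hS, G, neg_sub]
    simp only [stationaryKernel]
    ring
  have hmp := measurePreserving_finTwoArrow m
  have hpre : Set.pi univ ![scaleBall F k, scaleBall F l] =
      MeasurableEquiv.finTwoArrow ⁻¹' (scaleBall F k ×ˢ scaleBall F l) := by
    ext x
    simp [MeasurableEquiv.finTwoArrow]
  simp only [hdet2] at h2 ⊢
  rw [hpre] at h2 ⊢
  have h2' : IntegrableOn (fun p : F × F => G (p.2 - p.1)) (scaleBall F k ×ˢ scaleBall F l)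
      (m.prod m) :=
    (hmp.integrableOn_comp_preimage MeasurableEquiv.finTwoArrow.measurableEmbedding).1 h2
  have h4 := hmp.setIntegral_preimage_emb MeasurableEquiv.finTwoArrow.measurableEmbedding
    (fun p : F × F => G (p.2 - p.1)) (scaleBall F k ×ˢ scaleBall F l)
  refine (congrArg (· + _) (h4.trans (setIntegral_prod _ h2'))).trans ?_
  -- a ball is invariant under translation by its elements, so the inner integral is constant
  have hinner : ∀ x ∈ scaleBall F k, ∫ y in scaleBall F l, G (y - x) ∂m =
      ∫ u in scaleBall F l, G u ∂m := by
    intro x hx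
    rw [← integral_indicator (hball l), ← integral_indicator (hball l),
      ← integral_sub_right_eq_self ((scaleBall F l).indicator G) x]
    congr 1 with y
    have hiff : y - x ∈ scaleBall F l ↔ y ∈ scaleBall F l := by
      rw [← neg_mem_scaleBall_iff, neg_sub, sub_mem_scaleBall_iff (scaleBall_mono hF hkl hx)]
    by_cases hy : y ∈ scaleBall F l
    · rw [indicator_of_mem hy, indicator_of_mem (hiff.2 hy)]
    · rw [indicator_of_notMem hy, indicator_of_notMem (mt hiff.1 hy)]
  rw [setIntegral_congr_fun (hball k) hinner, setIntegral_const, measure_scaleBall hF m hm]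
  have : Fact (m (scaleBall F l) < ⊤) := ⟨measure_closedBall_lt_top⟩
  have hG : ∫ u in scaleBall F l, G u ∂m =
      (residueCard F : ℂ) ^ l * (m.real S * m.real S) - (m.real S - meanDefect m S (-l)) := by
    simp only [G]
    rw [integral_sub (integrable_const _) (integrableOn_fourierTransform_mul_neg hχ hS hS1 l),
      setIntegral_const, measure_scaleBall hF m hm, meanDefect_eq hF hm hχ hS hS1, sub_sub_cancel]
    simp
  rw [hG]
  simp only [Complex.real_smul]
  push_cast
  ring

end Moments

/-! ### Averages of sequences with geometrically decaying correlations -/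

section SecondMoment

variable {Ω : Type*} [MeasurableSpace Ω] {P : Measure Ω}

lemma sum_range_half_pow_sub (n : ℕ) :
    ∑ i ∈ Finset.range n, (1 / 2 : ℝ) ^ (n - i) = 1 - (1 / 2) ^ n := by
  induction n with
  | zero => simp
  | succ n ih =>
    rw [Finset.sum_range_succ, Nat.add_sub_cancel_left, Finset.sum_congr rfl fun i hi => by
      rw [Nat.succ_sub (Finset.mem_range.1 hi).le, pow_succ], ← Finset.sum_mul, ih, pow_succ]
    ring

lemma integrable_sq_sum_range {Y : ℕ → Ω → ℝ}
    (hint : ∀ i j, i ≤ j → Integrable (fun ω => Y i ω * Y j ω) P) (n : ℕ) :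
    Integrable (fun ω => (∑ i ∈ Finset.range n, Y i ω) ^ 2) P := by
  simp_rw [sq, Finset.sum_mul_sum]
  refine integrable_finsetSum _ fun i _ => integrable_finsetSum _ fun j _ => ?_
  rcases le_total i j with h | h
  · exact hint i j h
  · simpa only [mul_comm] using hint j i h

/-- Geometric decay of correlations makes the second moment of a sum grow at most linearly. -/
lemma integral_sq_sum_range_le {Y : ℕ → Ω → ℝ} {C : ℝ} (hC : 0 ≤ C)
    (hint : ∀ i j, i ≤ j → Integrable (fun ω => Y i ω * Y j ω) P)
    (hcov : ∀ i j, i ≤ j → ∫ ω, Y i ω * Y j ω ∂P ≤ C * (1 / 2) ^ (j - i)) (n : ℕ) :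
    ∫ ω, (∑ i ∈ Finset.range n, Y i ω) ^ 2 ∂P ≤ 3 * C * n := by
  induction n with
  | zero => simp
  | succ n ih =>
    have h1 : ∀ ω, (∑ i ∈ Finset.range (n + 1), Y i ω) ^ 2 =
        (∑ i ∈ Finset.range n, Y i ω) ^ 2 +
          (2 * ∑ i ∈ Finset.range n, Y i ω * Y n ω + Y n ω * Y n ω) := fun ω => by
      rw [Finset.sum_range_succ, ← Finset.sum_mul]
      ring
    have hi : ∀ i ∈ Finset.range n, Integrable (fun ω => Y i ω * Y n ω) P :=
      fun i hi => hint i n (Finset.mem_range.1 hi).le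
    have hsum : Integrable (fun ω => 2 * ∑ i ∈ Finset.range n, Y i ω * Y n ω) P :=
      (integrable_finsetSum _ hi).const_mul 2
    have hsum' : Integrable (fun ω => 2 * ∑ i ∈ Finset.range n, Y i ω * Y n ω + Y n ω * Y n ω) P :=
      hsum.add (hint n n le_rfl)
    simp_rw [h1]
    rw [integral_add (integrable_sq_sum_range hint n) hsum',
      integral_add hsum (hint n n le_rfl), integral_const_mul, integral_finsetSum _ hi]
    have h2 : ∑ i ∈ Finset.range n, ∫ ω, Y i ω * Y n ω ∂P ≤ C * (1 - (1 / 2) ^ n) := by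
      rw [← sum_range_half_pow_sub, Finset.mul_sum]
      exact Finset.sum_le_sum fun i hi => hcov i n (Finset.mem_range.1 hi).le
    have h3 : C * (1 - (1 / 2) ^ n) ≤ C := mul_le_of_le_one_right hC (by simp)
    have h4 := hcov n n le_rfl
    rw [Nat.sub_self, pow_zero, mul_one] at h4
    push_cast
    linarith

/-- A weak law of large numbers under geometric decay of correlations, along a subsequence. -/
lemma exists_strictMono_ae_tendsto_mean {Y : ℕ → Ω → ℝ} {C : ℝ} (hC : 0 ≤ C)
    (hint : ∀ i j, i ≤ j → Integrable (fun ω => Y i ω * Y j ω) P)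
    (hcov : ∀ i j, i ≤ j → ∫ ω, Y i ω * Y j ω ∂P ≤ C * (1 / 2) ^ (j - i)) :
    ∃ ns : ℕ → ℕ, StrictMono ns ∧ ∀ᵐ ω ∂P, Tendsto
      (fun j => ((ns j : ℝ) + 1)⁻¹ * ∑ i ∈ Finset.range (ns j + 1), Y i ω) atTop (𝓝 0) := by
  let D : ℕ → Ω → ℝ := fun n ω => ((n : ℝ) + 1)⁻¹ ^ 2 * (∑ i ∈ Finset.range (n + 1), Y i ω) ^ 2
  have hD : ∀ n, Integrable (D n) P := fun n => (integrable_sq_sum_range hint _).const_mul _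
  have hD0 : ∀ n ω, 0 ≤ D n ω := fun n ω => by positivity
  have hDle : ∀ n : ℕ, ∫ ω, D n ω ∂P ≤ 3 * C * ((n : ℝ) + 1)⁻¹ := fun n => by
    rw [integral_const_mul]
    have := integral_sq_sum_range_le hC hint hcov (n + 1)
    push_cast at this
    calc _ ≤ ((n : ℝ) + 1)⁻¹ ^ 2 * (3 * C * (n + 1)) := by gcongr
      _ = _ := by field_simp
  have hlim : Tendsto (fun n => ∫ ω, D n ω ∂P) atTop (𝓝 0) := by
    refine squeeze_zero (fun n => integral_nonneg (hD0 n)) hDle ?_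
    simpa [one_div] using (tendsto_one_div_add_atTop_nhds_zero_nat (𝕜 := ℝ)).const_mul (3 * C)
  have hmeas : TendstoInMeasure P D atTop 0 := by
    refine tendstoInMeasure_of_tendsto_eLpNorm one_ne_zero
      (fun n => (hD n).aestronglyMeasurable) aestronglyMeasurable_zero ?_
    have h : ∀ n, eLpNorm (D n - 0) 1 P = ENNReal.ofReal (∫ ω, D n ω ∂P) := fun n => by
      rw [sub_zero, eLpNorm_one_eq_lintegral_enorm,
        ofReal_integral_eq_lintegral_ofReal (hD n) (.of_forall (hD0 n))]
      exact lintegral_congr fun ω => Real.enorm_eq_ofReal (hD0 n ω)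
    simp_rw [h]
    simpa using ENNReal.tendsto_ofReal hlim
  obtain ⟨ns, hns, hae⟩ := hmeas.exists_seq_tendsto_ae
  refine ⟨ns, hns, hae.mono fun ω hω => ?_⟩
  rw [tendsto_zero_iff_abs_tendsto_zero]
  have h := (Real.continuous_sqrt.tendsto 0).comp hω
  rw [Real.sqrt_zero] at h
  refine h.congr fun j => ?_
  simp only [Function.comp_apply, D, ← mul_pow, Real.sqrt_sq_eq_abs]

end SecondMoment

/-! ### Rigidity -/

lemma Configuration.realCount_eq_add_diff {F : Type*} [PseudoMetricSpace F] {A B : Set F}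
    (hAB : B ⊆ A) (hA : Bornology.IsBounded A) (Y : Configuration F) :
    Y.realCount A = Y.realCount B + (Y.diff B).realCount A := by
  have h : Y.points ∩ A = Y.points ∩ B ∪ Y.points \ B ∩ A := by
    ext x
    have := @hAB x
    simp only [mem_inter_iff, mem_union, Set.mem_sdiff]
    tauto
  have hd : Disjoint (Y.points ∩ B) (Y.points \ B ∩ A) :=
    Set.disjoint_left.2 fun x hx hx' => hx'.1.2 hx.2
  simp only [realCount, diff]
  rw [h, ncard_union_eq hd (Y.finite_inter _ (hA.subset hAB)) ((Y.diff B).finite_inter _ hA)]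
  push_cast
  rfl

/-- The Ghosh–Peres criterion: if the averages of the centred counts in bounded sets containing `B`
tend to `0` almost surely, then the number of points in `B` is a function of the points outside. -/
lemma exists_measurable_count_eq {F Ω : Type*} [PseudoMetricSpace F] [MeasurableSpace F]
    [MeasurableSpace Ω] {P : Measure Ω} {X : Ω → Configuration F} {B : Set F} {A : ℕ → Set F}
    (hA : ∀ i, MeasurableSet (A i)) (hAb : ∀ i, Bornology.IsBounded (A i)) (hBA : ∀ i, B ⊆ A i)
    (e : ℕ → ℝ) (ns : ℕ → ℕ)
    (h : ∀ᵐ ω ∂P, Tendsto (fun j => ((ns j : ℝ) + 1)⁻¹ *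
      ∑ i ∈ Finset.range (ns j + 1), ((X ω).realCount (A i) - e i)) atTop (𝓝 0)) :
    ∃ N : Configuration F → ℕ∞, Measurable N ∧ ∀ᵐ ω ∂P, (X ω).count B = N ((X ω).diff B) := by
  let T : ℕ → Configuration F → ℝ := fun j Y =>
    ((ns j : ℝ) + 1)⁻¹ * ∑ i ∈ Finset.range (ns j + 1), (e i - Y.realCount (A i))
  have hT : ∀ j, Measurable (T j) := fun j => by
    have := fun i => Configuration.measurable_realCount (hA i)
    exact (Finset.measurable_fun_sum _ fun i _ => measurable_const.sub (this i)).const_mul _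
  have hR : Measurable fun n : ℕ => (n : ℕ∞) := measurable_from_top
  -- the value where `T j Y` does not converge, or not to a natural number, is irrelevant
  refine ⟨fun Y => (⌊limsup (fun j => T j Y) atTop⌋₊ : ℕ∞),
    hR.comp (Nat.measurable_floor.comp (Measurable.limsup hT)), h.mono fun ω hω => ?_⟩
  have h1 : ∀ j, T j ((X ω).diff B) = (X ω).realCount B - ((ns j : ℝ) + 1)⁻¹ *
      ∑ i ∈ Finset.range (ns j + 1), ((X ω).realCount (A i) - e i) := fun j => by
    have h2 : ∀ i, e i - ((X ω).diff B).realCount (A i) =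
        (X ω).realCount B - ((X ω).realCount (A i) - e i) := fun i => by
      rw [(X ω).realCount_eq_add_diff (hBA i) (hAb i)]
      ring
    have h3 : (ns j : ℝ) + 1 ≠ 0 := by positivity
    simp only [T, h2]
    rw [Finset.sum_sub_distrib, Finset.sum_const, Finset.card_range, nsmul_eq_mul, mul_sub]
    push_cast
    rw [inv_mul_cancel_left₀ h3]
  have hlim : Tendsto (fun j => T j ((X ω).diff B)) atTop (𝓝 ((X ω).realCount B)) := by
    simp_rw [h1]
    simpa using hω.const_sub ((X ω).realCount B)
  simp only [hlim.limsup_eq]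
  rw [Configuration.realCount, Nat.floor_natCast, Configuration.count]
  exact (((X ω).finite_inter _ ((hAb 0).subset (hBA 0))).cast_ncard_eq).symm

theorem theorem1 {F : Type*} [NontriviallyNormedField F] [IsUltrametricDist F]
    [LocallyCompactSpace F] (hF : IsStandardNorm F)
    [MeasurableSpace F] [BorelSpace F]
    (m : Measure F) [m.IsAddHaarMeasure] (hm : m (Metric.closedBall 0 1) = 1)
    (χ : AddChar F Circle) (hχ : IsConductorCharacter χ)
    (S : Set F) (hS : NullMeasurableSet S m) (hS0 : 0 < m S) (hS1 : m S < ⊤)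
    (hO : (fun n : ℕ => ⨍ y in Metric.closedBall (0 : F) ((residueCard F : ℝ)⁻¹ ^ n),
        m.real (S \ ((fun s => s + y) '' S)) ∂m)
      =O[atTop] fun n : ℕ => (residueCard F : ℝ)⁻¹ ^ n)
    {Ω : Type*} [MeasurableSpace Ω] (P : Measure Ω) [IsProbabilityMeasure P]
    (X : Ω → Configuration F) (hX : Measurable X)
    (hdet : IsDeterminantal P X m (stationaryKernel χ m S)) :
    IsNumberRigid P X := by
  have := ProperSpace.of_locallyCompactSpace F (E := F)
  have hq : (2 : ℝ) ≤ residueCard F := by exact_mod_cast hF.one_lt_residueCard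
  have hq0 : (0 : ℝ) < residueCard F := by linarith
  intro B _ hB
  obtain ⟨T, -, hT, hTS⟩ := hS.exists_measurable_superset_ae_eq
  have hT1 : m T ≠ ⊤ := (measure_congr hTS).trans_lt hS1 |>.ne
  rw [stationaryKernel_congr hTS.symm] at hdet
  obtain ⟨C, hC0, hC⟩ := hO.exists_nonneg
  obtain ⟨n₁, hn₁⟩ := eventually_atTop.1 hC.bound
  obtain ⟨R, hR⟩ := hB.subset_closedBall 0
  obtain ⟨n₂, hn₂⟩ := pow_unbounded_of_one_lt R (show (1 : ℝ) < residueCard F by linarith)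
  -- all radii exceed the one of a ball around `B`, and the bound on the mean defect holds from the
  -- first of them on
  let s : ℕ → ℤ := fun i => ((n₁ + n₂ + i : ℕ) : ℤ)
  have hdefect : ∀ i, meanDefect m T (-s i) ≤ C * (residueCard F : ℝ) ^ (-s i) := fun i => by
    have h := hn₁ (n₁ + n₂ + i) (by omega)
    have e : ((residueCard F : ℝ)⁻¹) ^ (n₁ + n₂ + i) = (residueCard F : ℝ) ^ (-s i) := by
      rw [zpow_neg, zpow_natCast, inv_pow]
    rw [e, Real.norm_of_nonneg (show 0 ≤ (residueCard F : ℝ) ^ (-s i) by positivity)] at h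
    rw [meanDefect_congr hTS]
    exact (Real.le_norm_self _).trans h
  let e : ℕ → ℝ := fun i => (residueCard F : ℝ) ^ s i * m.real T
  let Y : ℕ → Ω → ℝ := fun i ω => (X ω).realCount (scaleBall F (s i)) - e i
  have hcov : ∀ i j, i ≤ j → Integrable (fun ω => Y i ω * Y j ω) P ∧
      ∫ ω, Y i ω * Y j ω ∂P ≤ C * (1 / 2) ^ (j - i) := by
    intro i j hij
    have hsij : s i ≤ s j := by simp only [s]; omega
    obtain ⟨a1, a2⟩ := hdet.mean_count hF hm hT (s i)
    obtain ⟨b1, b2⟩ := hdet.mean_count hF hm hT (s j)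
    obtain ⟨c1, c2⟩ := hdet.mean_count_mul_count hF hm hχ hT hT1 hsij
    have hY : (fun ω => Y i ω * Y j ω) = fun ω =>
        (X ω).realCount (scaleBall F (s i)) * (X ω).realCount (scaleBall F (s j)) -
        e j * (X ω).realCount (scaleBall F (s i)) - e i * (X ω).realCount (scaleBall F (s j)) +
        e i * e j := by
      ext ω
      simp only [Y]
      ring
    have d1 : Integrable (fun ω =>
        (X ω).realCount (scaleBall F (s i)) * (X ω).realCount (scaleBall F (s j)) -
        e j * (X ω).realCount (scaleBall F (s i))) P := c1.sub (a1.const_mul (e j))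
    have d2 : Integrable (fun ω =>
        (X ω).realCount (scaleBall F (s i)) * (X ω).realCount (scaleBall F (s j)) -
        e j * (X ω).realCount (scaleBall F (s i)) -
        e i * (X ω).realCount (scaleBall F (s j))) P := d1.sub (b1.const_mul (e i))
    rw [hY]
    refine ⟨d2.add (integrable_const _), ?_⟩
    rw [integral_add d2 (integrable_const _), integral_sub d1 (b1.const_mul _),
      integral_sub c1 (a1.const_mul _), integral_const_mul, integral_const_mul, a2, b2, c2]
    simp only [integral_const, probReal_univ, smul_eq_mul, one_mul, e]
    calc _ = (residueCard F : ℝ) ^ s i * meanDefect m T (-s j) := by ring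
      _ ≤ (residueCard F : ℝ) ^ s i * (C * (residueCard F : ℝ) ^ (-s j)) := by
        gcongr
        exact hdefect j
      _ = C * (residueCard F : ℝ)⁻¹ ^ (j - i) := by
        rw [mul_left_comm, ← zpow_add₀ hq0.ne', inv_pow, ← zpow_natCast, ← zpow_neg]
        congr 2
        simp only [s]
        omega
      _ ≤ C * (1 / 2) ^ (j - i) := by
        rw [one_div]
        gcongr
  obtain ⟨ns, -, hns⟩ := exists_strictMono_ae_tendsto_mean hC0
    (fun i j hij => (hcov i j hij).1) fun i j hij => (hcov i j hij).2
  refine exists_measurable_count_eq (fun _ => Metric.isClosed_closedBall.measurableSet)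
    (fun _ => Metric.isBounded_closedBall) (fun i => ?_) e ns hns
  refine hR.trans ((Metric.closedBall_subset_closedBall ?_).trans
    (scaleBall_mono hF (show (n₂ : ℤ) ≤ s i by simp only [s]; omega)))
  rw [zpow_natCast]
  exact hn₂.le
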